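/- All graphs are finite and simple. $K_s$ denotes the complete graph on $s$ vertices, $I_t$ the edgeless graph on $t$ vertices, $G\cup H$ the disjoint union, and $G\vee H$ the join of $G$ and $H$ (the disjoint union together with all edges between $G$ and $H$). The spectral radius $\lambda(G)$ is the largest eigenvalue of the adjacency matrix of $G$, and $\delta(G)$ is the minimum degree of $G$. A graph $G=(V,E)$ is called $k$-Hamiltonian if for every $X\subseteq V$ with $|X|\le k$ the subgraph induced by $V\setminus X$ has a Hamilton cycle. For integers $k\ge 0$, $\delta\ge k+2$ and $n\ge 2\delta$ put $$H_{n,k,\delta}=K_\delta\vee\bigl(K_{n-2\delta+k}\cup I_{\delta-k}\bigr),\qquad L_{n,k,\delta}=K_{k+1}\vee\bigl(K_{n-\delta-1}\cup K_{\delta-k}\bigr).$$ **Theorem.** For all integers $k\ge 0$ and $\delta\ge k+2$ there is an integer $N=N(k,\delta)$ such that for every $n\ge N$ the following holds. If $G$ is an $n$-vertex graph with minimum degree $\delta(G)\ge\delta$ and $$\lambda(G)\ge n-\delta+k-1,$$ then $G$ is $k$-Hamiltonian, or $G$ is isomorphic to $H_{n,k,\delta}$, or $G$ is isomorphic to $L_{n,k,\delta}$.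 -/

import Mathlib

namespace HamSpectral

/-- The join `G ∨ H`: the disjoint union of `G` and `H` together with all edges between them. -/
def join {V W : Type*} (G : SimpleGraph V) (H : SimpleGraph W) : SimpleGraph (V ⊕ W) :=
  (G ⊕g H) ⊔ completeBipartiteGraph V W

/-- The complete graph `K_s`. -/
abbrev K (s : ℕ) : SimpleGraph (Fin s) := ⊤

/-- The edgeless graph `I_t`. -/
abbrev I (t : ℕ) : SimpleGraph (Fin t) := ⊥

/-- `H_{n,k,δ} = K_δ ∨ (K_{n-2δ+k} ∪ I_{δ-k})`; it has `n` vertices when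
`k ≤ δ` and `2 * δ ≤ n + k`. -/
def graphH (n k δ : ℕ) : SimpleGraph (Fin δ ⊕ (Fin (n + k - 2 * δ) ⊕ Fin (δ - k))) :=
  join (K δ) (K (n + k - 2 * δ) ⊕g I (δ - k))

/-- `L_{n,k,δ} = K_{k+1} ∨ (K_{n-δ-1} ∪ K_{δ-k})`; it has `n` vertices when
`k ≤ δ` and `δ + 1 ≤ n`. -/
def graphL (n k δ : ℕ) : SimpleGraph (Fin (k + 1) ⊕ (Fin (n - δ - 1) ⊕ Fin (δ - k))) :=
  join (K (k + 1)) (K (n - δ - 1) ⊕g K (δ - k))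

/-- The spectral radius `λ(G)`: the largest root of the characteristic polynomial of the real
adjacency matrix (the set of roots is finite, and nonempty when `G` has a vertex). -/
noncomputable def spectralRadius {V : Type*} [Fintype V] [DecidableEq V]
    (G : SimpleGraph V) [DecidableRel G.Adj] : ℝ :=
  sSup {μ : ℝ | (G.adjMatrix ℝ).charpoly.IsRoot μ}

/-- `G` is `k`-Hamiltonian: for every set `X` of at most `k` vertices, the subgraph induced by
the remaining vertices contains a Hamilton cycle. -/
def IsKHamiltonian {V : Type*} [DecidableEq V] (k : ℕ) (G : SimpleGraph V) : Prop :=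
  ∀ X : Finset V, X.card ≤ k →
    ∃ (a : {v : V | v ∉ X}) (p : (G.induce {v : V | v ∉ X}).Walk a a), p.IsHamiltonianCycle

end HamSpectral

/-! Put s = δ - k, so the hypothesis reads λ(G) ≥ n - s - 1 = λ(K_{n-s}). Suppose deleting a set X
of at most k vertices leaves a set U on which G has no Hamilton cycle, and let H ⊇ G be edge-maximal
without one. By Bondy–Chvátal, H joins any two vertices whose degrees in U sum to at least |U|
(`exists_closed_of_not_hamOn`).

The spectral bound allows G, hence H on U, at most s n missing edges (`sum_degIn_compl_le`). In H
the vertices of U of degree at least |U|/2 form a clique, and counting missing edges shows that the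
set B of the others has at most s elements (`card_lowDeg_le`). Closedness bounds the degrees in B by
|B|, while δ(G) ≥ δ and |X| ≤ k force them to be at least s. So |B| = s, all these degrees equal s,
and B is completely joined to a set T and to nothing else in U \ B. If 1 < |T| < s, then H would be
Hamiltonian on U; hence B is independent with |T| = s, or a clique with |T| = 1
(`extremal_structure`).

Equality in δ ≤ s + |X| carries the neighbourhoods of B over from H to G and joins B to all of X.
Finally, B has so little eigenvector weight that a missing edge outside B would force λ(G) < n - s -
1 (`isClique_compl_of_le_spectralRadius`). This leaves only the two extremal graphs. -/

namespace HamSpectral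

open Finset

variable {V : Type*}

/-! ### Hamilton cycles as vertex lists and the Bondy–Chvátal closure. -/

/-- The list `l` runs once through the vertices of `U`, in the order of a Hamilton cycle of
`G[U]`. -/
structure IsHamList (G : SimpleGraph V) (U : Finset V) (l : List V) : Prop where
  nodup : l.Nodup
  mem_iff : ∀ v, v ∈ l ↔ v ∈ U
  three_le : 3 ≤ l.length
  chain : l.IsChain G.Adj
  closes : ∀ x ∈ l.getLast?, ∀ y ∈ l.head?, G.Adj x y

/-- `G[U]` has a Hamilton cycle. -/
def HamOn (G : SimpleGraph V) (U : Finset V) : Prop := ∃ l, IsHamList G U l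

theorem IsHamList.rotate {G : SimpleGraph V} {U : Finset V} {a b : List V}
    (hl : IsHamList G U (a ++ b)) : IsHamList G U (b ++ a) := by
  rcases a.eq_nil_or_concat with rfl | ⟨a', x, rfl⟩
  · simpa using hl
  rcases b with _ | ⟨y, b'⟩
  · simpa using hl
  have hc := List.isChain_append.1 hl.chain
  refine ⟨?_, fun v => ?_, ?_, ?_, ?_⟩
  · exact List.nodup_append_comm.1 hl.nodup
  · rw [← hl.mem_iff v, List.mem_append, List.mem_append, or_comm]
  · have := hl.three_le
    simp only [List.length_append] at this ⊢
    omega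
  · refine List.isChain_append.2 ⟨hc.2.1, hc.1, fun p hp q hq => hl.closes p ?_ q ?_⟩
    · rw [List.getLast?_append_of_ne_nil _ (by simp)]; exact hp
    · rw [List.head?_append_of_ne_nil _ (by simp)]; exact hq
  · intro p hp q hq
    refine hc.2.2 p ?_ q ?_
    · rwa [List.getLast?_append_of_ne_nil _ (by simp)] at hp
    · rwa [List.head?_append_of_ne_nil _ (by simp)] at hq

/-- A vertex list of a Hamilton path of `G[U]` from `u` to `v`. -/
structure IsHamPathList (G : SimpleGraph V) (U : Finset V) (u v : V) (l : List V) : Prop where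
  nodup : l.Nodup
  mem_iff : ∀ v, v ∈ l ↔ v ∈ U
  three_le : 3 ≤ l.length
  chain : l.IsChain G.Adj
  head : l.head? = some u
  last : l.getLast? = some v

theorem IsHamPathList.reverse {G : SimpleGraph V} {U : Finset V} {u v : V} {l : List V}
    (hl : IsHamPathList G U u v l) : IsHamPathList G U v u l.reverse where
  nodup := List.nodup_reverse.2 hl.nodup
  mem_iff := by simpa using hl.mem_iff
  three_le := by simpa using hl.three_le
  chain := by
    rw [List.isChain_reverse]
    exact hl.chain.imp fun _ _ h => h.symm
  head := by simpa using hl.last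
  last := by simpa using hl.head

/-- The closing pair must be the added edge. Since the list has no repetition and length at least 3,
no consecutive pair is that edge again, so the list is a path in G. -/
theorem IsHamList.hamPath_of_not_closes {G : SimpleGraph V} {U : Finset V} {u v : V} {l : List V}
    (hl : IsHamList (G ⊔ SimpleGraph.edge u v) U l)
    (hbad : ¬ ∀ x ∈ l.getLast?, ∀ y ∈ l.head?, G.Adj x y) :
    ∃ l', IsHamPathList G U u v l' := by
  push Not at hbad
  obtain ⟨x, hx, y, hy, hxy⟩ := hbad
  have hlen := hl.three_le
  have h0 : l[0] = y := by
    rw [Option.mem_def, List.head?_eq_getElem?, List.getElem?_eq_some_iff] at hy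
    exact hy.2
  have h1 : l[l.length - 1] = x := by
    rw [Option.mem_def, List.getLast?_eq_getElem?, List.getElem?_eq_some_iff] at hx
    exact hx.2
  have hadj := hl.closes x hx y hy
  simp only [SimpleGraph.sup_adj, hxy, false_or, SimpleGraph.edge_adj] at hadj
  have hch : l.IsChain G.Adj := by
    rw [List.isChain_iff_getElem]
    intro i hi
    have h := List.isChain_iff_getElem.1 hl.chain i hi
    rw [SimpleGraph.sup_adj] at h
    refine h.resolve_right fun h => ?_
    rw [SimpleGraph.edge_adj] at h
    have inj : ∀ (p q : ℕ) (hp : p < l.length) (hq : q < l.length), l[p] = l[q] → p = q :=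
      fun p q hp hq h => (hl.nodup.getElem_inj_iff).1 h
    have key : (l[i] = l[l.length - 1] ∧ l[i + 1] = l[0]) ∨
        (l[i] = l[0] ∧ l[i + 1] = l[l.length - 1]) := by
      grind
    rcases key with ⟨_, h⟩ | ⟨h, h'⟩
    · have := inj _ _ _ _ h
      omega
    · have := inj _ _ _ _ h
      have := inj _ _ _ _ h'
      omega
  rcases hadj.1 with ⟨rfl, rfl⟩ | ⟨rfl, rfl⟩
  · exact ⟨_, IsHamPathList.reverse ⟨hl.nodup, hl.mem_iff, hlen, hch, hy, hx⟩⟩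
  · exact ⟨l, hl.nodup, hl.mem_iff, hlen, hch, hy, hx⟩

/-- If the added edge is used inside the list, rotating there makes it the closing pair. -/
theorem IsHamList.hamOn_or_hamPath {G : SimpleGraph V} {U : Finset V} {u v : V} {l : List V}
    (hl : IsHamList (G ⊔ SimpleGraph.edge u v) U l) :
    HamOn G U ∨ ∃ l', IsHamPathList G U u v l' := by
  by_cases hcl : ∀ x ∈ l.getLast?, ∀ y ∈ l.head?, G.Adj x y
  swap
  · exact .inr (hl.hamPath_of_not_closes hcl)
  by_cases hch : l.IsChain G.Adj
  · exact .inl ⟨l, hl.nodup, hl.mem_iff, hl.three_le, hch, hcl⟩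
  rw [List.isChain_iff_getElem] at hch
  push Not at hch
  obtain ⟨i, hi, hbad⟩ := hch
  have hl' : IsHamList (G ⊔ SimpleGraph.edge u v) U (l.drop (i + 1) ++ l.take (i + 1)) := by
    apply IsHamList.rotate
    rwa [List.take_append_drop]
  refine .inr (hl'.hamPath_of_not_closes fun h => hbad (h _ ?_ _ ?_))
  · rw [List.getLast?_append_of_ne_nil _ (by
      rw [ne_eq, List.take_eq_nil_iff]; rintro (h | h)
      · omega
      · subst h; simp at hi)]
    simp [List.getLast?_take, List.getElem?_eq_getElem (show i < l.length by omega)]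
  · rw [List.head?_append_of_ne_nil _ (by rw [ne_eq, List.drop_eq_nil_iff]; omega)]
    simp [List.head?_drop, hi]

open Classical in
/-- The number of neighbours of `v` in `U`. -/
noncomputable def degIn (G : SimpleGraph V) (U : Finset V) (v : V) : ℕ := #{w ∈ U | G.Adj v w}

theorem degIn_mono {G H : SimpleGraph V} (h : G ≤ H) {U W : Finset V} (hUW : U ⊆ W) (v : V) :
    degIn G U v ≤ degIn H W v := by
  classical
  refine card_le_card fun w => ?_
  simp only [mem_filter]
  exact fun hw => ⟨hUW hw.1, h hw.2⟩

theorem degIn_eq_of_list {G : SimpleGraph V} {U : Finset V} {l : List V} (hnd : l.Nodup)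
    (hmem : ∀ v, v ∈ l ↔ v ∈ U) [DecidableRel G.Adj] (v : V) :
    degIn G U v = #{i ∈ range l.length | ∃ h : i < l.length, G.Adj v l[i]} := by
  classical
  symm
  refine card_bij (fun i hi => l[i]'(by simpa using (mem_filter.1 hi).1)) ?_ ?_ ?_
  · intro i hi
    obtain ⟨h1, h2, h3⟩ := mem_filter.1 hi
    simp only [mem_filter]
    exact ⟨(hmem _).1 (List.getElem_mem _), h3⟩
  · intro i hi j hj h
    exact hnd.getElem_inj_iff.1 h
  · intro w hw
    simp only [mem_filter] at hw
    obtain ⟨i, hi, rfl⟩ := List.getElem_of_mem ((hmem w).2 hw.1)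
    exact ⟨i, by simp [hi, hw.2], rfl⟩

/-- Ore's crossing argument: among the |U| - 1 consecutive pairs of the path, pigeonhole gives one
with u adjacent to its second vertex and v to its first. Reversing the tail of the path there yields
a cycle. -/
theorem IsHamPathList.hamOn {G : SimpleGraph V} {U : Finset V} {u v : V} {l : List V}
    (hl : IsHamPathList G U u v l) (hdeg : #U ≤ degIn G U u + degIn G U v) : HamOn G U := by
  classical
  have hlen := hl.three_le
  have hcard : #U = l.length := by
    rw [← List.toFinset_card_of_nodup hl.nodup]
    congr 1
    ext v
    simp [hl.mem_iff]
  have h0 : l[0] = u := by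
    have := hl.head
    rw [List.head?_eq_getElem?, List.getElem?_eq_some_iff] at this
    exact this.2
  have h1 : l[l.length - 1] = v := by
    have := hl.last
    rw [List.getLast?_eq_getElem?, List.getElem?_eq_some_iff] at this
    exact this.2
  obtain ⟨i, hi, hiu, hiv⟩ : ∃ i, ∃ h : i + 1 < l.length, G.Adj u l[i + 1] ∧ G.Adj v l[i] := by
    by_contra! hno
    have hu : degIn G U u ≤ #{i ∈ range (l.length - 1) | ∃ h : i + 1 < l.length, G.Adj u l[i + 1]} := by
      rw [degIn_eq_of_list hl.nodup hl.mem_iff]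
      refine card_le_card_of_surjOn (· + 1) fun j hj => ?_
      simp only [coe_filter, mem_range, Set.mem_ofPred_eq] at hj
      obtain ⟨hj, _, hadj⟩ := hj
      rcases j with _ | j
      · rw [h0] at hadj; exact absurd hadj (G.loopless.irrefl _)
      · exact ⟨j, by simp; exact ⟨by omega, hj, hadj⟩, rfl⟩
    have hv : degIn G U v ≤ #{i ∈ range (l.length - 1) | ∃ h : i < l.length, G.Adj v l[i]} := by
      rw [degIn_eq_of_list hl.nodup hl.mem_iff]
      refine card_le_card fun j hj => ?_
      simp only [mem_filter, mem_range] at hj ⊢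
      obtain ⟨hj, _, hadj⟩ := hj
      refine ⟨?_, hj, hadj⟩
      by_contra hlt
      have : j = l.length - 1 := by omega
      subst this
      rw [h1] at hadj; exact absurd hadj (G.loopless.irrefl _)
    have hdisj : Disjoint {i ∈ range (l.length - 1) | ∃ h : i + 1 < l.length, G.Adj u l[i + 1]}
        {i ∈ range (l.length - 1) | ∃ h : i < l.length, G.Adj v l[i]} := by
      rw [disjoint_filter]
      rintro j - ⟨hj, ha⟩ ⟨hj', hb⟩
      exact hno j hj ha hb
    have := card_union_of_disjoint hdisj
    have hsub := card_le_card (union_subset (filter_subset _ _) (filter_subset _ _) :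
      {i ∈ range (l.length - 1) | ∃ h : i + 1 < l.length, G.Adj u l[i + 1]} ∪
        {i ∈ range (l.length - 1) | ∃ h : i < l.length, G.Adj v l[i]} ⊆ range (l.length - 1))
    rw [card_range] at hsub
    omega
  have hc := hl.chain
  rw [← List.take_append_drop (i + 1) l, List.isChain_append] at hc
  have hp : (l.take (i + 1) ++ (l.drop (i + 1)).reverse).Perm l := by
    conv_rhs => rw [← List.take_append_drop (i + 1) l]
    exact (List.reverse_perm _).append_left _
  have hne : l.take (i + 1) ≠ [] := by
    rw [ne_eq, List.take_eq_nil_iff]; rintro (h | h)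
    · omega
    · subst h; simp at hi
  have hne' : (l.drop (i + 1)).reverse ≠ [] := by
    rw [ne_eq, List.reverse_eq_nil_iff, List.drop_eq_nil_iff]; omega
  refine ⟨l.take (i + 1) ++ (l.drop (i + 1)).reverse, hp.nodup_iff.2 hl.nodup,
    fun w => by rw [hp.mem_iff, hl.mem_iff], by rw [hp.length_eq]; exact hlen, ?_, ?_⟩
  · refine List.isChain_append.2 ⟨hc.1, ?_, ?_⟩
    · rw [List.isChain_reverse]
      exact hc.2.1.imp fun _ _ h => h.symm
    · intro x hx y hy
      have hx' : x = l[i] := by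
        simpa [List.getLast?_take, List.getElem?_eq_getElem (show i < l.length by omega),
          eq_comm] using hx
      have hy' : y = v := by
        rw [List.head?_reverse, List.getLast?_drop, if_neg (by omega), hl.last] at hy
        simpa [eq_comm] using hy
      subst hx' hy'
      exact hiv.symm
  · intro x hx y hy
    rw [List.getLast?_append_of_ne_nil _ hne', List.getLast?_reverse, List.head?_drop] at hx
    rw [List.head?_append_of_ne_nil _ hne, List.head?_take, if_neg (by omega), hl.head] at hy
    have hx' : x = l[i + 1] := by simpa [List.getElem?_eq_getElem hi, eq_comm] using hx
    have hy' : y = u := by simpa [eq_comm] using hy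
    subst hx' hy'
    exact hiu.symm

/-- The step of the Bondy–Chvátal closure. -/
theorem HamOn.of_sup_edge {G : SimpleGraph V} {U : Finset V} {u v : V}
    (h : HamOn (G ⊔ SimpleGraph.edge u v) U) (hdeg : #U ≤ degIn G U u + degIn G U v) :
    HamOn G U := by
  obtain ⟨l, hl⟩ := h
  rcases hl.hamOn_or_hamPath with h | ⟨l', hl'⟩
  · exact h
  · exact hl'.hamOn hdeg

/-- A graph without a Hamilton cycle on `U` lies in one that is closed under joining two vertices
of `U` whose degrees in `U` sum to at least `#U`. -/
theorem exists_closed_of_not_hamOn [Finite V] {G : SimpleGraph V} {U : Finset V}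
    (h : ¬ HamOn G U) : ∃ H, G ≤ H ∧ ¬ HamOn H U ∧
      ∀ u v, u ≠ v → #U ≤ degIn H U u + degIn H U v → H.Adj u v := by
  -- A maximal non-Hamiltonian supergraph replaces the iterated closure.
  obtain ⟨H, hGH, hmax⟩ := Set.Finite.exists_le_maximal
    (Set.toFinite {H : SimpleGraph V | ¬ HamOn H U}) (show G ∈ {H | ¬ HamOn H U} from h)
  refine ⟨H, hGH, hmax.prop, fun u v huv hdeg => ?_⟩
  by_contra hadj
  have hlt : ¬ (H ⊔ SimpleGraph.edge u v ≤ H) := fun hle =>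
    hadj (hle (.inr (by simp [SimpleGraph.edge_adj, huv])))
  have : HamOn (H ⊔ SimpleGraph.edge u v) U := by
    by_contra hno
    exact hlt (hmax.le_of_ge hno le_sup_left)
  exact hmax.prop (this.of_sup_edge hdeg)

/-! ### Ore's theorem and gluing a clique into a cycle. -/

theorem isChain_of_clique {G : SimpleGraph V} {l : List V} (hnd : l.Nodup)
    (hcl : ∀ u ∈ l, ∀ v ∈ l, u ≠ v → G.Adj u v) : l.IsChain G.Adj :=
  List.Pairwise.isChain (hnd.imp_of_mem fun hu hv huv => hcl _ hu _ hv huv)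

theorem hamOn_of_clique {G : SimpleGraph V} {U : Finset V} (hU : 3 ≤ #U)
    (hcl : ∀ u ∈ U, ∀ v ∈ U, u ≠ v → G.Adj u v) : HamOn G U := by
  have hlen : U.toList.length = #U := length_toList U
  refine ⟨U.toList, U.nodup_toList, fun v => mem_toList, by omega,
    isChain_of_clique U.nodup_toList (by simpa using hcl), fun x hx y hy => ?_⟩
  have hx' := List.mem_of_getLast? hx
  have hy' := List.mem_of_head? hy
  refine hcl x (by simpa using hx') y (by simpa using hy') ?_
  rw [Option.mem_def, List.getLast?_eq_getElem?, List.getElem?_eq_some_iff] at hx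
  rw [Option.mem_def, List.head?_eq_getElem?, List.getElem?_eq_some_iff] at hy
  obtain ⟨_, rfl⟩ := hx
  obtain ⟨_, rfl⟩ := hy
  intro h
  have := U.nodup_toList.getElem_inj_iff.1 h
  omega

/-- Ore's theorem. -/
theorem hamOn_of_ore [Finite V] {G : SimpleGraph V} {U : Finset V} (hU : 3 ≤ #U)
    (hdeg : ∀ u ∈ U, ∀ v ∈ U, u ≠ v → ¬ G.Adj u v → #U ≤ degIn G U u + degIn G U v) :
    HamOn G U := by
  by_contra h
  obtain ⟨H, hGH, hH, hcl⟩ := exists_closed_of_not_hamOn h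
  refine hH (hamOn_of_clique hU fun u hu v hv huv => ?_)
  by_cases hadj : G.Adj u v
  · exact hGH hadj
  · exact hcl u v huv ((hdeg u hu v hv huv hadj).trans
      (add_le_add (degIn_mono hGH le_rfl u) (degIn_mono hGH le_rfl v)))

/-- A Hamilton cycle on `U` through `w` can be extended by a clique `W` all of whose vertices are
joined to `w`, if some vertex `t` of `W` is joined to all of `U`. -/
theorem HamOn.union_clique [DecidableEq V] {G : SimpleGraph V} {U W : Finset V} {w t : V}
    (h : HamOn G U) (hdisj : Disjoint U W) (hw : w ∈ U) (ht : t ∈ W)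
    (hcl : ∀ u ∈ W, ∀ v ∈ W, u ≠ v → G.Adj u v) (hwW : ∀ v ∈ W, G.Adj v w)
    (htU : ∀ u ∈ U, G.Adj u t) : HamOn G (U ∪ W) := by
  obtain ⟨l₀, hl₀⟩ := h
  obtain ⟨a, b, rfl⟩ := List.append_of_mem ((hl₀.mem_iff w).2 hw)
  have hl := hl₀.rotate
  rw [List.cons_append] at hl
  set r := b ++ a
  have hmemW : ∀ v, v ∈ t :: (W.erase t).toList ↔ v ∈ W := fun v => by
    by_cases hv : v = t <;> simp [hv, ht]
  have hndW : (t :: (W.erase t).toList).Nodup := by simp [nodup_toList]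
  -- The cycle is cut just before w. Its last vertex, whichever it is, is joined to t, and the last
  -- vertex of W closes up at w.
  refine ⟨(w :: r) ++ (t :: (W.erase t).toList), ?_, fun v => ?_, ?_, ?_, ?_⟩
  · refine List.nodup_append.2 ⟨hl.nodup, hndW, fun x hx y hy => ?_⟩
    exact Finset.disjoint_iff_ne.1 hdisj x ((hl.mem_iff x).1 hx) y ((hmemW y).1 hy)
  · rw [List.mem_append, hl.mem_iff, hmemW, mem_union]
  · have := hl.three_le
    rw [List.length_append]
    omega
  · refine List.isChain_append.2 ⟨hl.chain, isChain_of_clique hndW fun u hu v hv =>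
      hcl u ((hmemW u).1 hu) v ((hmemW v).1 hv), fun x hx y hy => ?_⟩
    have : y = t := by simpa [eq_comm] using hy
    subst this
    exact htU x ((hl.mem_iff x).1 (List.mem_of_getLast? hx))
  · intro x hx y hy
    have : y = w := by simpa [eq_comm] using hy
    subst this
    rw [List.getLast?_append_of_ne_nil _ (by simp)] at hx
    exact hwW x ((hmemW x).1 (List.mem_of_getLast? hx))

/-- A Hamilton list gives a Hamilton cycle of the induced subgraph. -/
theorem HamOn.exists_isHamiltonianCycle [DecidableEq V] {G : SimpleGraph V} {U : Finset V}
    {S : Set V} (hS : ∀ v, v ∈ S ↔ v ∈ U) (h : HamOn G U) :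
    ∃ (a : S) (p : (G.induce S).Walk a a), p.IsHamiltonianCycle := by
  obtain ⟨l, hl⟩ := h
  have hmem : ∀ v ∈ l, v ∈ S := fun v hv => (hS v).2 ((hl.mem_iff v).1 hv)
  have hlen := hl.three_le
  have hne : l ≠ [] := by rintro rfl; simp at hlen
  set q := (SimpleGraph.Walk.ofSupport l hne hl.chain).induce S
    (by simpa using hmem) with hq
  have hsup : q.support = l.attachWith _ hmem := by
    simp [hq]
  have hqlen : q.length + 1 = l.length := by
    rw [← SimpleGraph.Walk.length_support, hsup, List.length_attachWith]
  have hqp : q.IsPath := by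
    rw [SimpleGraph.Walk.isPath_def, hsup]
    refine List.Nodup.of_map Subtype.val ?_
    simpa using hl.nodup
  have hqh : q.IsHamiltonian := hqp.isHamiltonian_of_mem fun v => by
    rw [hsup]
    simpa [hl.mem_iff] using (hS v).1 v.2
  have hadj : (G.induce S).Adj ⟨l.getLast hne, hmem _ (List.getLast_mem hne)⟩
      ⟨l.head hne, hmem _ (List.head_mem hne)⟩ :=
    hl.closes _ (List.getLast?_eq_some_getLast hne) _ (List.head?_eq_some_head hne)
  refine ⟨_, SimpleGraph.Walk.cons hadj q, ?_, ?_⟩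
  · rw [SimpleGraph.Walk.isCycle_iff_isPath_tail_and_le_length]
    refine ⟨by simpa using hqp, ?_⟩
    rw [SimpleGraph.Walk.length_cons]
    omega
  · intro v
    simpa using hqh v

/-! ### Counting degrees and missing edges inside a set. -/

theorem degIn_add_degIn_compl (G : SimpleGraph V) {U : Finset V} {v : V} (hv : v ∈ U) :
    degIn G U v + degIn Gᶜ U v + 1 = #U := by
  classical
  have h1 := card_filter_add_card_filter_not (s := U.erase v) (G.Adj v)
  have h2 := card_erase_add_one hv
  have h3 : ({w ∈ U.erase v | G.Adj v w} : Finset V) = {w ∈ U | G.Adj v w} := by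
    ext w
    simp only [mem_filter, mem_erase]
    exact ⟨fun h => ⟨h.1.2, h.2⟩, fun h => ⟨⟨h.2.ne', h.1⟩, h.2⟩⟩
  have h4 : ({w ∈ U.erase v | ¬ G.Adj v w} : Finset V) = {w ∈ U | Gᶜ.Adj v w} := by
    ext w
    simp only [mem_filter, mem_erase, SimpleGraph.compl_adj]
    constructor
    · exact fun h => ⟨h.1.2, h.1.1.symm, h.2⟩
    · exact fun h => ⟨⟨h.2.1.symm, h.1⟩, h.2.2⟩
  rw [h3, h4] at h1
  unfold degIn
  rw [← h2, ← h1]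
  congr!

theorem degIn_union [DecidableEq V] (G : SimpleGraph V) {A B : Finset V} (h : Disjoint A B)
    (v : V) : degIn G (A ∪ B) v = degIn G A v + degIn G B v := by
  classical
  unfold degIn
  rw [filter_union, card_union_of_disjoint (disjoint_filter_filter h)]

theorem degIn_le_card (G : SimpleGraph V) (U : Finset V) (v : V) : degIn G U v ≤ #U :=
  by classical exact card_le_card (filter_subset _ _)

theorem degIn_eq_card_iff {G : SimpleGraph V} {U : Finset V} {v : V} :
    degIn G U v = #U ↔ ∀ w ∈ U, G.Adj v w :=
  @card_filter_eq_iff V U (fun w => G.Adj v w) (fun _ => Classical.propDecidable _)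

theorem degIn_eq_zero_iff {G : SimpleGraph V} {U : Finset V} {v : V} :
    degIn G U v = 0 ↔ ∀ w ∈ U, ¬ G.Adj v w := by
  classical
  unfold degIn
  rw [card_eq_zero, filter_eq_empty_iff]

theorem sum_degIn_comm (G : SimpleGraph V) (A B : Finset V) :
    ∑ a ∈ A, degIn G B a = ∑ b ∈ B, degIn G A b := by
  classical
  have := sum_card_bipartiteAbove_eq_sum_card_bipartiteBelow (s := A) (t := B) G.Adj
  unfold degIn
  unfold bipartiteAbove bipartiteBelow at this
  simp only [G.adj_comm _ (_ : V)] at this ⊢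
  convert this using 4

/-! ### Structure of a closed non-Hamiltonian graph. -/

/-- The vertices of `U` adjacent in `G` to fewer than half of the vertices of `U`. -/
noncomputable def lowDeg (G : SimpleGraph V) (U : Finset V) : Finset V :=
  {v ∈ U | 2 * degIn G U v < #U}

section Closed

variable [DecidableEq V] {G : SimpleGraph V} {U : Finset V}

theorem adj_of_notMem_lowDeg
    (hcl : ∀ u v, u ≠ v → #U ≤ degIn G U u + degIn G U v → G.Adj u v)
    {u v : V} (hu : u ∈ U \ lowDeg G U) (hv : v ∈ U \ lowDeg G U)
    (huv : u ≠ v) : G.Adj u v := by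
  simp only [lowDeg, mem_sdiff, mem_filter, not_and, not_lt] at hu hv
  have := hu.2 hu.1
  have := hv.2 hv.1
  exact hcl u v huv (by omega)

theorem degIn_compl_le_card_lowDeg
    (hcl : ∀ u v, u ≠ v → #U ≤ degIn G U u + degIn G U v → G.Adj u v)
    {w : V} (hw : w ∈ U \ lowDeg G U) :
    degIn Gᶜ U w ≤ degIn Gᶜ (lowDeg G U) w := by
  classical
  refine card_le_card fun v hv => ?_
  simp only [mem_filter] at hv ⊢
  refine ⟨?_, hv.2⟩
  by_contra hvB
  exact hv.2.2 (adj_of_notMem_lowDeg hcl hw (mem_sdiff.2 ⟨hv.1, hvB⟩) hv.2.1)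

/-- A low vertex b has a non-neighbour w of high degree, since otherwise its degree would be at
least |U| - |B| ≥ |U|/2. As w misses only vertices of B, its degree is at least |U| - 1 - |B|, and
closedness bounds that of b. -/
theorem degIn_le_of_mem_lowDeg
    (hcl : ∀ u v, u ≠ v → #U ≤ degIn G U u + degIn G U v → G.Adj u v)
    {b : V} (hb : b ∈ lowDeg G U) (hB : 2 * #(lowDeg G U) ≤ #U) :
    degIn G U b ≤ #(lowDeg G U) := by
  have hsub : lowDeg G U ⊆ U := filter_subset _ _
  obtain ⟨w, hw, hbw⟩ : ∃ w ∈ U \ lowDeg G U, ¬ G.Adj b w := by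
    by_contra! hno
    have h1 := degIn_eq_card_iff.2 hno
    have h2 := degIn_mono (le_refl G) (sdiff_subset (s := U) (t := lowDeg G U)) b
    have h3 := card_sdiff_add_card_eq_card hsub
    have h4 := (mem_filter.1 hb).2
    omega
  have hne : b ≠ w := by rintro rfl; exact (mem_sdiff.1 hw).2 hb
  have h1 : ¬ #U ≤ degIn G U b + degIn G U w := fun h => hbw (hcl b w hne h)
  have h2 := degIn_add_degIn_compl G (mem_sdiff.1 hw).1
  have h3 := degIn_compl_le_card_lowDeg hcl hw
  have h4 := degIn_le_card Gᶜ (lowDeg G U) w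
  omega

/-- Bootstrapping: a crude count gives |B| ≤ 4s, which makes the sharper degree bound |B| available.
Then each low vertex misses almost all of U, and counting the missing pairs from both ends improves
4s to s. -/
theorem card_lowDeg_le
    (hcl : ∀ u v, u ≠ v → #U ≤ degIn G U u + degIn G U v → G.Adj u v)
    {s k n : ℕ} (hn : n ≤ #U + k)
    (hsum : ∑ v ∈ U, degIn Gᶜ U v ≤ 2 * s * n)
    (h₁ : 4 * s * k + 8 * s + 2 ≤ #U) (h₂ : 2 * s * k + (s + 1) * (12 * s + 1) < 2 * #U) :
    #(lowDeg G U) ≤ s := by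
  have hsub : lowDeg G U ⊆ U := filter_subset _ _
  have hco : ∀ b ∈ lowDeg G U, #U ≤ 2 * degIn Gᶜ U b + 1 := fun b hb => by
    have := degIn_add_degIn_compl G (hsub hb)
    have := (mem_filter.1 hb).2
    omega
  have hsplit := sum_sdiff (f := degIn Gᶜ U) hsub
  have h4 : #(lowDeg G U) ≤ 4 * s := by
    by_contra! hlt
    have h := card_nsmul_le_sum (lowDeg G U) (fun b => 2 * degIn Gᶜ U b + 1) _ hco
    rw [sum_add_distrib, ← mul_sum, sum_const, smul_eq_mul, smul_eq_mul, mul_one] at h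
    obtain ⟨m, hm⟩ : ∃ m, #U = m + 1 := ⟨#U - 1, by omega⟩
    have h3 : ∑ b ∈ lowDeg G U, degIn Gᶜ U b ≤ 2 * s * n := by omega
    have h5 : #(lowDeg G U) * m ≤ 4 * s * n := by
      rw [hm, mul_add, mul_one] at h
      linarith
    have h6 : (4 * s + 1) * m ≤ #(lowDeg G U) * m := Nat.mul_le_mul_right _ hlt
    have h7 : 4 * s * n ≤ 4 * s * (m + 1 + k) := Nat.mul_le_mul_left _ (by omega)
    have h8 : (4 * s + 1) * m ≤ 4 * s * (m + 1 + k) := by omega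
    ring_nf at h8 h₁
    nlinarith
  have hB : 2 * #(lowDeg G U) ≤ #U := by
    have : 0 ≤ 4 * s * k := Nat.zero_le _
    omega
  by_contra! hlt
  have hlow : #(lowDeg G U) * (#U - 1 - #(lowDeg G U)) ≤ ∑ b ∈ lowDeg G U, degIn Gᶜ U b := by
    rw [← smul_eq_mul]
    refine card_nsmul_le_sum _ _ _ fun b hb => ?_
    have := degIn_add_degIn_compl G (hsub hb)
    have := degIn_le_of_mem_lowDeg hcl hb hB
    omega
  -- The missing pairs between B and U \ B, counted again from the other end.
  have hhigh : #(lowDeg G U) * (#U - 2 * #(lowDeg G U)) ≤ ∑ w ∈ U \ lowDeg G U, degIn Gᶜ U w := by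
    calc _ ≤ ∑ b ∈ lowDeg G U, degIn Gᶜ (U \ lowDeg G U) b := by
          rw [← smul_eq_mul]
          refine card_nsmul_le_sum _ _ _ fun b hb => ?_
          have h1 := degIn_add_degIn_compl G (hsub hb)
          have h2 := degIn_le_of_mem_lowDeg hcl hb hB
          have h3 := degIn_union Gᶜ (sdiff_disjoint (s := lowDeg G U) (t := U)) b
          rw [sdiff_union_of_subset hsub] at h3
          have h4 := degIn_add_degIn_compl G hb
          omega
      _ = ∑ w ∈ U \ lowDeg G U, degIn Gᶜ (lowDeg G U) w := sum_degIn_comm _ _ _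
      _ ≤ _ := sum_le_sum fun w _ => degIn_mono le_rfl hsub w
  generalize #(lowDeg G U) = β at *
  obtain ⟨p, hp⟩ : ∃ p, #U = p + 1 + 2 * β := ⟨#U - 1 - 2 * β, by omega⟩
  have e1 : #U - 1 - β = p + β := by omega
  have e2 : #U - 2 * β = p + 1 := by omega
  rw [e1] at hlow
  rw [e2] at hhigh
  have h7 : 2 * s * n ≤ 2 * s * (#U + k) := Nat.mul_le_mul_left _ hn
  have h8 : β * (p + β) + β * (p + 1) ≤ 2 * s * (#U + k) := by omega
  obtain ⟨q, hq⟩ : ∃ q, #U = q + 8 * s := ⟨#U - 8 * s, by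
    have : 0 ≤ 4 * s * k := Nat.zero_le _
    omega⟩
  -- The loss is 3β + 1, with β ≤ 4s from the crude bound.
  have h9 : 2 * #U ≤ (p + β) + (p + 1) + 12 * s + 1 := by omega
  have h10 : (s + 1) * ((p + β) + (p + 1)) ≤ 2 * s * (#U + k) := by
    refine le_trans (Nat.mul_le_mul_right _ hlt) ?_
    linarith
  have h11 : (s + 1) * (2 * #U) ≤ (s + 1) * ((p + β) + (p + 1)) + (s + 1) * (12 * s + 1) := by
    rw [← mul_add]
    exact Nat.mul_le_mul_left _ (by omega)
  nlinarith

/-- A vertex outside B with one neighbour in B misses at most s - 1 vertices; its degree plus s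
reaches |U|, so it is joined to all of B. These vertices form T, and each b has s - |T| neighbours
inside B. -/
theorem extremal_structure [Finite V]
    (hcl : ∀ u v, u ≠ v → #U ≤ degIn G U u + degIn G U v → G.Adj u v)
    {s : ℕ} (hs : 2 ≤ s) (hnot : ¬ HamOn G U)
    (hdeg : ∀ v ∈ U, s ≤ degIn G U v) (hcard : #(lowDeg G U) ≤ s) (hU : 2 * s + 3 ≤ #U) :
    ∃ B T : Finset V, B ⊆ U ∧ T ⊆ U \ B ∧ #B = s ∧ (∀ b ∈ B, degIn G U b = s) ∧
      (∀ b ∈ B, ∀ w ∈ U \ B, G.Adj b w ↔ w ∈ T) ∧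
      ((#T = s ∧ ∀ b ∈ B, ∀ b' ∈ B, ¬ G.Adj b b') ∨
        (#T = 1 ∧ ∀ b ∈ B, ∀ b' ∈ B, b ≠ b' → G.Adj b b')) := by
  classical
  have hclique := @adj_of_notMem_lowDeg V _ G U hcl
  have hco := @degIn_compl_le_card_lowDeg V _ G U hcl
  have hlow := @degIn_le_of_mem_lowDeg V _ G U hcl
  have hBU : lowDeg G U ⊆ U := filter_subset _ _
  generalize lowDeg G U = B at *
  obtain ⟨b₀, hb₀⟩ : B.Nonempty := by
    by_contra hne
    rw [not_nonempty_iff_eq_empty] at hne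
    subst hne
    refine hnot (hamOn_of_clique (by omega) fun u hu v hv => hclique (by simpa) (by simpa))
  have hle : ∀ b ∈ B, degIn G U b ≤ #B := fun b hb => hlow hb (by omega)
  have hBs : #B = s := le_antisymm hcard ((hdeg _ (hBU hb₀)).trans (hle _ hb₀))
  have hd : ∀ b ∈ B, degIn G U b = s := fun b hb =>
    le_antisymm (hBs ▸ hle b hb) (hdeg _ (hBU hb))
  set T : Finset V := {w ∈ U \ B | ∃ b ∈ B, G.Adj w b} with hT
  have hTU : T ⊆ U \ B := filter_subset _ _
  have hadj : ∀ b ∈ B, ∀ w ∈ T, G.Adj b w := by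
    intro b hb w hw
    obtain ⟨hwU, b', hb', hwb'⟩ := mem_filter.1 hw
    have h1 := hco hwU
    have h2 : degIn Gᶜ B w < #B := by
      refine lt_of_le_of_ne (degIn_le_card _ _ _) fun h => ?_
      exact (degIn_eq_card_iff.1 h b' hb').2 hwb'
    have h3 := degIn_add_degIn_compl G (mem_sdiff.1 hwU).1
    refine hcl b w ?_ ?_
    · rintro rfl; exact (mem_sdiff.1 hwU).2 hb
    · rw [hd b hb]; omega
  have hiff : ∀ b ∈ B, ∀ w ∈ U \ B, G.Adj b w ↔ w ∈ T := fun b hb w hw =>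
    ⟨fun h => mem_filter.2 ⟨hw, b, hb, h.symm⟩, hadj b hb w⟩
  have hdT : ∀ b ∈ B, #T + degIn G B b = s := fun b hb => by
    have h1 := degIn_union G (sdiff_disjoint (s := B) (t := U)) b
    rw [sdiff_union_of_subset hBU, hd b hb] at h1
    rw [h1]
    congr 1
    unfold degIn
    congr 1
    ext w
    simp only [mem_filter]
    exact ⟨fun h => ⟨hTU h, hadj b hb w h⟩, fun h => (hiff b hb w h.1).1 h.2⟩
  have hBT : Disjoint B T := disjoint_left.2 fun x hx hx' => (mem_sdiff.1 (hTU hx')).2 hx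
  refine ⟨B, T, hBU, hTU, hBs, hd, hiff, ?_⟩
  rcases eq_or_ne (#T) s with hTs | hTs
  · refine .inl ⟨hTs, fun b hb b' hb' => ?_⟩
    exact degIn_eq_zero_iff.1 (by have := hdT b hb; omega) b' hb'
  rcases eq_or_ne (#T) 1 with hT1 | hT1
  · refine .inr ⟨hT1, fun b hb b' hb' hne => ?_⟩
    have h1 := hdT b hb
    have h2 := degIn_add_degIn_compl G hb
    have h3 := degIn_eq_zero_iff.1 (show degIn Gᶜ B b = 0 by omega) b' hb'
    rw [SimpleGraph.compl_adj] at h3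
    tauto
  exfalso
  have hT2 : 1 < #T := by
    have h1 := hdT b₀ hb₀
    have h2 := degIn_add_degIn_compl G hb₀
    omega
  have hTlt : #T < s := lt_of_le_of_ne (by have := hdT b₀ hb₀; omega) hTs
  obtain ⟨t, ht, t', ht', htt'⟩ := one_lt_card.1 hT2
  have htU := mem_sdiff.1 (hTU ht)
  have ht'U := mem_sdiff.1 (hTU ht')
  have hTe := card_erase_add_one ht
  have hdisj : Disjoint B (T.erase t) := hBT.mono_right (erase_subset _ _)
  have huniv : ∀ w ∈ T, ∀ u ∈ U, u ≠ w → G.Adj u w := fun w hw u hu hne => by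
    by_cases hub : u ∈ B
    · exact hadj u hub w hw
    · exact hclique (mem_sdiff.2 ⟨hu, hub⟩) (hTU hw) hne
  have hcard' : #(B ∪ T.erase t) = s + #T - 1 := by
    rw [card_union_of_disjoint hdisj]
    omega
  have hsubU : B ∪ T.erase t ⊆ U :=
    union_subset hBU ((erase_subset _ _).trans (hTU.trans sdiff_subset))
  -- One vertex t of T is kept back for gluing. Non-adjacent vertices here lie in B and have degree
  -- s - 1, so Ore's condition is 2(s - 1) ≥ s + |T| - 1, that is |T| < s.
  have hsmall : HamOn G (B ∪ T.erase t) := by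
    refine hamOn_of_ore (by omega) fun u hu v hv huv hnadj => ?_
    have key : ∀ u ∈ B, degIn G (B ∪ T.erase t) u = s - 1 := fun u hu => by
      rw [degIn_union G hdisj,
        degIn_eq_card_iff.2 fun w hw => hadj u hu w (mem_of_mem_erase hw)]
      have := hdT u hu
      omega
    have hu' : u ∈ B := by
      by_contra hub
      have huT : u ∈ T := mem_of_mem_erase ((mem_union.1 hu).resolve_left hub)
      exact hnadj (huniv u huT v (hsubU hv) huv.symm).symm
    have hv' : v ∈ B := by
      by_contra hvb
      have hvT : v ∈ T := mem_of_mem_erase ((mem_union.1 hv).resolve_left hvb)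
      exact hnadj (huniv v hvT u (hsubU hu) huv)
    rw [key u hu', key v hv', hcard']
    omega
  have hW : ∀ {w}, w ∈ U \ (B ∪ T.erase t) → w ∈ U \ B := fun {w} hw =>
    sdiff_subset_sdiff le_rfl subset_union_left hw
  have htW : t ∈ U \ (B ∪ T.erase t) := by simp [htU.1, htU.2]
  have ht'S : t' ∈ B ∪ T.erase t := by simp [ht', htt'.symm]
  have := hsmall.union_clique (W := U \ (B ∪ T.erase t)) (w := t') (t := t) disjoint_sdiff
    ht'S htW
    (fun u hu v hv => hclique (hW hu) (hW hv))
    (fun v hv => huniv t' ht' v (mem_sdiff.1 hv).1 fun h => (mem_sdiff.1 hv).2 (h ▸ ht'S))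
    (fun u hu => huniv t ht u (hsubU hu) fun h => (mem_sdiff.1 htW).2 (h ▸ hu))
  rw [union_sdiff_of_subset hsubU] at this
  exact hnot this

end Closed

/-! ### Consequences of a large spectral radius. -/

section Spectral

theorem degIn_eq_card_filter (G : SimpleGraph V) [DecidableRel G.Adj] (U : Finset V) (v : V) :
    degIn G U v = #{w ∈ U | G.Adj v w} := by
  unfold degIn
  congr!

variable [Fintype V]

theorem degIn_univ (G : SimpleGraph V) [DecidableRel G.Adj] (v : V) :
    degIn G univ v = G.degree v := by
  rw [degIn_eq_card_filter, ← SimpleGraph.card_neighborFinset_eq_degree,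
    SimpleGraph.neighborFinset_eq_filter]

/-- Positivity excludes an empty root set, whose `sSup` is 0. -/
theorem isRoot_spectralRadius [DecidableEq V] {G : SimpleGraph V} [DecidableRel G.Adj]
    (h : 0 < spectralRadius G) : (G.adjMatrix ℝ).charpoly.IsRoot (spectralRadius G) := by
  have hfin : {μ : ℝ | (G.adjMatrix ℝ).charpoly.IsRoot μ}.Finite :=
    Polynomial.finite_setOfPred_isRoot (Matrix.charpoly_monic _).ne_zero
  rcases Set.eq_empty_or_nonempty {μ : ℝ | (G.adjMatrix ℝ).charpoly.IsRoot μ} with hne | hne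
  · rw [spectralRadius, hne, Real.sSup_empty] at h
    exact absurd h (lt_irrefl _)
  · exact hne.csSup_mem hfin

/-- A positive lower bound `c` for the spectral radius yields a nonnegative vector `y` with
maximum entry `1` and `A y ≥ c y`. -/
theorem exists_subeigenvector [DecidableEq V] {G : SimpleGraph V} [DecidableRel G.Adj] {c : ℝ}
    (hc : 0 < c) (h : c ≤ spectralRadius G) :
    ∃ y : V → ℝ, (∀ v, 0 ≤ y v) ∧ (∀ v, y v ≤ 1) ∧ (∃ v, y v = 1) ∧
      ∀ v, c * y v ≤ ∑ u with G.Adj v u, y u := by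
  set μ := spectralRadius G
  have hμ : 0 < μ := hc.trans_le h
  have hroot := isRoot_spectralRadius hμ
  obtain ⟨x, hx0, hx⟩ : ∃ x : V → ℝ, x ≠ 0 ∧ (G.adjMatrix ℝ).mulVec x = μ • x := by
    rw [Polynomial.IsRoot, Matrix.eval_charpoly] at hroot
    obtain ⟨x, hx0, hx⟩ := Matrix.exists_mulVec_eq_zero_iff.2 hroot
    refine ⟨x, hx0, ?_⟩
    rw [Matrix.sub_mulVec, sub_eq_zero] at hx
    rw [← hx, Matrix.scalar_apply, ← Matrix.smul_one_eq_diagonal, Matrix.smul_mulVec,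
      Matrix.one_mulVec]
  obtain ⟨v₀, hv₀⟩ : ∃ v, x v ≠ 0 := Function.ne_iff.1 hx0
  obtain ⟨w, -, hw⟩ := exists_max_image univ (fun v => |x v|) ⟨v₀, mem_univ _⟩
  have hwpos : 0 < |x w| := (abs_pos.2 hv₀).trans_le (hw v₀ (mem_univ _))
  -- Absolute values of any eigenvector suffice, by the triangle inequality; Perron–Frobenius is not
  -- needed.
  refine ⟨fun v => |x v| / |x w|, fun v => by positivity,
    fun v => (div_le_one hwpos).2 (hw v (mem_univ _)), ⟨w, div_self hwpos.ne'⟩, fun v => ?_⟩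
  rw [← sum_div, ← mul_div_assoc]
  refine div_le_div_of_nonneg_right ?_ hwpos.le
  have hv := congrFun hx v
  rw [SimpleGraph.adjMatrix_mulVec_apply, Pi.smul_apply, smul_eq_mul,
    SimpleGraph.neighborFinset_eq_filter] at hv
  calc c * |x v| ≤ μ * |x v| := mul_le_mul_of_nonneg_right h (abs_nonneg _)
    _ = |∑ u with G.Adj v u, x u| := by rw [hv, abs_mul, abs_of_pos hμ]
    _ ≤ _ := abs_sum_le_sum_abs _ _

/-- A graph of positive minimum degree with spectral radius at least `n - s - 1` misses at most
`s n` edges. -/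
theorem sum_degIn_compl_le [DecidableEq V] {G : SimpleGraph V} [DecidableRel G.Adj] {s : ℕ}
    (hs : s + 1 < Fintype.card V) (hdeg : ∀ v, 1 ≤ degIn G univ v)
    (h : (Fintype.card V : ℝ) - s - 1 ≤ spectralRadius G) :
    ∑ v, degIn Gᶜ univ v ≤ 2 * s * Fintype.card V := by
  set n := Fintype.card V with hn
  have hs' : (s : ℝ) + 1 < n := by exact_mod_cast hs
  obtain ⟨y, hy0, hy1, ⟨w, hw⟩, hy⟩ := exists_subeigenvector (by linarith) h
  set c : ℝ := n - s - 1 with hc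
  have hcpos : 0 < c := by linarith
  -- The inequality A y ≥ c y is used twice, starting from the maximal entry y w = 1.
  have hsq : c * c ≤ ∑ u with G.Adj w u, (degIn G univ u : ℝ) := by
    have h1 := hy w
    rw [hw, mul_one] at h1
    calc c * c ≤ c * ∑ u with G.Adj w u, y u := mul_le_mul_of_nonneg_left h1 hcpos.le
      _ = ∑ u with G.Adj w u, c * y u := mul_sum _ _ _
      _ ≤ _ := sum_le_sum fun u _ => (hy u).trans ?_
    calc _ ≤ ∑ v with G.Adj u v, (1 : ℝ) := sum_le_sum fun v _ => hy1 v
      _ = _ := by rw [sum_const, degIn_eq_card_filter, nsmul_eq_mul, mul_one]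
  -- The degree of w, plus at least 1 for each other non-neighbour of w, is at least n - 1.
  have hrest : n ≤ ∑ u with ¬ G.Adj w u, degIn G univ u + 1 := by
    have hwmem : w ∈ ({u | ¬ G.Adj w u} : Finset V) := by simp
    rw [← add_sum_erase _ _ hwmem]
    have h1 : #(({u | ¬ G.Adj w u} : Finset V).erase w) ≤
        ∑ u ∈ ({u | ¬ G.Adj w u} : Finset V).erase w, degIn G univ u := by
      rw [card_eq_sum_ones]
      exact sum_le_sum fun u _ => hdeg u
    have h2 := card_erase_add_one hwmem
    have h3 := card_filter_add_card_filter_not (s := (univ : Finset V)) (G.Adj w)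
    rw [← degIn_eq_card_filter, card_univ] at h3
    omega
  have hsplit := sum_filter_add_sum_filter_not univ (G.Adj w) (degIn G univ)
  have htot : ∑ v, degIn G univ v + ∑ v, degIn Gᶜ univ v + n = n * n := by
    have h1 : ∀ v ∈ (univ : Finset V), degIn G univ v + degIn Gᶜ univ v + 1 = n := fun v hv =>
      degIn_add_degIn_compl G hv
    have h2 := sum_congr rfl h1
    rwa [sum_add_distrib, sum_add_distrib, sum_const, sum_const, card_univ, smul_eq_mul,
      smul_eq_mul, mul_one] at h2
  rw [← Nat.cast_sum] at hsq
  have h1 : (n : ℝ) ≤ (∑ u with ¬ G.Adj w u, degIn G univ u : ℕ) + 1 := by exact_mod_cast hrest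
  have h2 : ((∑ v, degIn G univ v : ℕ) : ℝ) + (∑ v, degIn Gᶜ univ v : ℕ) + n = n * n := by
    exact_mod_cast htot
  rw [← hsplit, Nat.cast_add] at h2
  have : ((∑ v, degIn Gᶜ univ v : ℕ) : ℝ) ≤ 2 * s * n := by
    rw [hc] at hsq
    nlinarith [Nat.cast_nonneg (α := ℝ) s]
  exact_mod_cast this

/-- If all vertices of a set `B` of `s` vertices have degree at most `d`, and the spectral radius
is at least that of a clique on the other vertices, then the other vertices form a clique,
provided there are enough of them. -/
theorem isClique_compl_of_le_spectralRadius [DecidableEq V] {G : SimpleGraph V}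
    [DecidableRel G.Adj] {B : Finset V} {s d : ℕ} (hB : #B = s)
    (hdeg : ∀ b ∈ B, degIn G univ b ≤ d)
    (hn : s * d * (d + 1) + d + s + 1 < Fintype.card V)
    (h : (Fintype.card V : ℝ) - s - 1 ≤ spectralRadius G) :
    ∀ p ∈ univ \ B, ∀ q ∈ univ \ B, p ≠ q → G.Adj p q := by
  set n := Fintype.card V with hnn
  have hn' : (s : ℝ) * d * (d + 1) + d + s + 1 < n := by exact_mod_cast hn
  have hsd : (0 : ℝ) ≤ (s : ℝ) * d * (d + 1) := by positivity
  have hd0 : (0 : ℝ) ≤ d := Nat.cast_nonneg d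
  have hs0 : (0 : ℝ) ≤ s := Nat.cast_nonneg s
  obtain ⟨y, hy0, hy1, ⟨w, hw⟩, hy⟩ := exists_subeigenvector (by linarith) h
  set c : ℝ := n - s - 1 with hc
  have hcpos : 0 < c := by linarith
  set D : Finset V := univ \ B with hD
  have hdisj : Disjoint D B := sdiff_disjoint
  have huniv : D ∪ B = univ := sdiff_union_of_subset (subset_univ B)
  have hDcard : (#D : ℝ) = c + 1 := by
    have : #D + #B = n := by
      rw [hD, hnn, ← card_univ]; exact card_sdiff_add_card_eq_card (subset_univ B)
    rw [hB] at this
    have : (#D : ℝ) + s = n := by exact_mod_cast this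
    rw [hc]; linarith
  have hyB : ∀ b ∈ B, c * y b ≤ d := fun b hb => by
    calc _ ≤ ∑ v with G.Adj b v, y v := hy b
      _ ≤ ∑ v with G.Adj b v, (1 : ℝ) := sum_le_sum fun v _ => hy1 v
      _ = (degIn G univ b : ℝ) := by
          rw [sum_const, degIn_eq_card_filter, nsmul_eq_mul, mul_one]
      _ ≤ d := by exact_mod_cast hdeg b hb
  have hsumB : c * ∑ b ∈ B, y b ≤ s * d := by
    rw [mul_sum, ← hB, ← nsmul_eq_mul]
    exact sum_le_card_nsmul _ _ _ hyB
  have hwD : w ∈ D := by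
    rw [hD, mem_sdiff]
    refine ⟨mem_univ _, fun hwB => ?_⟩
    have := hyB w hwB
    rw [hw] at this
    linarith
  set S := ∑ u ∈ D, y u with hS
  have hSlow : c * (c + 1) ≤ c * S + s * d := by
    have h1 := hy w
    rw [hw, mul_one] at h1
    have h2 : ∑ u with G.Adj w u, y u ≤ ∑ u ∈ univ.erase w, y u := by
      refine sum_le_sum_of_subset_of_nonneg (fun u hu => ?_) fun u _ _ => hy0 u
      simpa using (mem_filter.1 hu).2.ne'
    have h3 := add_sum_erase univ y (mem_univ w)
    have h4 : c + 1 ≤ ∑ u, y u := by linarith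
    rw [← huniv, sum_union hdisj] at h4
    nlinarith [mul_le_mul_of_nonneg_left h4 hcpos.le]
  -- The entries on D sum to nearly |D| = c + 1 and are at most 1, so each is near 1.
  have hylow : ∀ u ∈ D, c ≤ c * y u + s * d := fun u hu => by
    have h1 := add_sum_erase D y hu
    have h2 : ∑ v ∈ D.erase u, y v ≤ c := by
      calc _ ≤ ∑ v ∈ D.erase u, (1 : ℝ) := sum_le_sum fun v _ => hy1 v
        _ = c := by
          rw [sum_const, nsmul_eq_mul, mul_one]
          have := card_erase_add_one hu
          have : (#(D.erase u) : ℝ) + 1 = #D := by exact_mod_cast this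
          linarith
    nlinarith [mul_le_mul_of_nonneg_left h2 hcpos.le]
  intro p hp q hq hpq
  by_contra hadj
  have hdD : ∀ u ∈ D, (degIn G D u : ℝ) ≤ c := fun u hu => by
    have h1 := degIn_add_degIn_compl G hu
    have : (degIn G D u : ℝ) + degIn Gᶜ D u + 1 = #D := by exact_mod_cast h1
    have h2 : (0 : ℝ) ≤ degIn Gᶜ D u := Nat.cast_nonneg _
    linarith
  have hdp : (degIn G D p : ℝ) ≤ c - 1 := by
    have h1 := degIn_add_degIn_compl G hp
    have : (degIn G D p : ℝ) + degIn Gᶜ D p + 1 = #D := by exact_mod_cast h1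
    have h2 : 1 ≤ degIn Gᶜ D p := by
      rw [Nat.one_le_iff_ne_zero]
      exact fun h0 => degIn_eq_zero_iff.1 h0 q hq ⟨hpq, hadj⟩
    have h2 : (1 : ℝ) ≤ degIn Gᶜ D p := by exact_mod_cast h2
    linarith
  have hswap : ∑ v ∈ D, ∑ u with G.Adj v u, y u = ∑ u, degIn G D u * y u := by
    simp_rw [sum_filter]
    rw [sum_comm]
    refine sum_congr rfl fun u _ => ?_
    rw [← sum_filter, sum_const, nsmul_eq_mul, degIn_eq_card_filter]
    simp_rw [G.adj_comm u]
  have h1 : c * S ≤ ∑ u, degIn G D u * y u := by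
    rw [← hswap, hS, mul_sum]
    exact sum_le_sum fun v _ => hy v
  rw [← huniv, sum_union hdisj] at h1
  -- The missing edge pq costs y p, near 1, while by `h3` the set B can repay only d times its
  -- weight, at most s d² / c. Together they give c ≤ s d (d + 1), against `hn`.
  have h2 : ∑ u ∈ D, degIn G D u * y u ≤ c * S - y p := by
    rw [hS, mul_sum, ← add_sum_erase D _ hp, ← add_sum_erase D (fun i => c * y i) hp]
    have : ∑ u ∈ D.erase p, degIn G D u * y u ≤ ∑ u ∈ D.erase p, c * y u :=
      sum_le_sum fun u hu => mul_le_mul_of_nonneg_right (hdD u (mem_of_mem_erase hu)) (hy0 u)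
    have := mul_le_mul_of_nonneg_right hdp (hy0 p)
    linarith
  have h3 : ∑ b ∈ B, degIn G D b * y b ≤ d * ∑ b ∈ B, y b := by
    rw [mul_sum]
    refine sum_le_sum fun b hb => mul_le_mul_of_nonneg_right ?_ (hy0 b)
    exact_mod_cast (degIn_mono le_rfl (subset_univ D) b).trans (hdeg b hb)
  have h4 : y p ≤ d * ∑ b ∈ B, y b := by linarith
  have h5 := mul_le_mul_of_nonneg_left h4 hcpos.le
  have h6 := mul_le_mul_of_nonneg_left hsumB hd0
  have h7 := hylow p hp
  nlinarith

end Spectral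

/-! ### Recognising the extremal graphs and conclusion. -/

theorem exists_equiv_of_partition [Fintype V] [DecidableEq V] {A C B : Finset V} {a c b : ℕ}
    (hA : #A = a) (hC : #C = c) (hB : #B = b) (hAC : Disjoint A C) (hAB : Disjoint A B)
    (hCB : Disjoint C B) (huniv : ∀ v, v ∈ A ∨ v ∈ C ∨ v ∈ B) :
    ∃ f : Fin a ⊕ (Fin c ⊕ Fin b) ≃ V, (∀ i, f (.inl i) ∈ A) ∧ (∀ i, f (.inr (.inl i)) ∈ C) ∧
      ∀ i, f (.inr (.inr i)) ∈ B := by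
  let eA := (A.equivFinOfCardEq hA).symm
  let eC := (C.equivFinOfCardEq hC).symm
  let eB := (B.equivFinOfCardEq hB).symm
  let f : Fin a ⊕ (Fin c ⊕ Fin b) → V :=
    Sum.elim (fun i => eA i) (Sum.elim (fun i => eC i) (fun i => eB i))
  have hf : Function.Bijective f := by
    constructor
    · refine (Subtype.val_injective.comp eA.injective).sumElim
        ((Subtype.val_injective.comp eC.injective).sumElim
          (Subtype.val_injective.comp eB.injective) fun i j => ?_) fun i j => ?_
      · exact disjoint_iff_ne.1 hCB _ (eC i).2 _ (eB j).2
      · rcases j with j | j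
        · exact disjoint_iff_ne.1 hAC _ (eA i).2 _ (eC j).2
        · exact disjoint_iff_ne.1 hAB _ (eA i).2 _ (eB j).2
    · intro v
      rcases huniv v with h | h | h
      · exact ⟨.inl (eA.symm ⟨v, h⟩), by simp [f]⟩
      · exact ⟨.inr (.inl (eC.symm ⟨v, h⟩)), by simp [f]⟩
      · exact ⟨.inr (.inr (eB.symm ⟨v, h⟩)), by simp [f]⟩
  exact ⟨Equiv.ofBijective f hf, fun i => (eA i).2, fun i => (eC i).2, fun i => (eB i).2⟩

theorem nonempty_iso_join [Fintype V] [DecidableEq V] {G : SimpleGraph V} {A C B : Finset V}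
    {a c b : ℕ} {R : SimpleGraph (Fin b)}
    (hA : #A = a) (hC : #C = c) (hB : #B = b) (hAC : Disjoint A C) (hAB : Disjoint A B)
    (hCB : Disjoint C B) (huniv : ∀ v, v ∈ A ∨ v ∈ C ∨ v ∈ B)
    (hclique : ∀ u ∈ A ∪ C, ∀ v ∈ A ∪ C, u ≠ v → G.Adj u v)
    (hfull : ∀ u ∈ A, ∀ v ∈ B, G.Adj u v) (hnone : ∀ u ∈ C, ∀ v ∈ B, ¬ G.Adj u v)
    (hR : (R = ⊤ ∧ ∀ u ∈ B, ∀ v ∈ B, u ≠ v → G.Adj u v) ∨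
      (R = ⊥ ∧ ∀ u ∈ B, ∀ v ∈ B, ¬ G.Adj u v)) :
    Nonempty (G ≃g join (K a) (K c ⊕g R)) := by
  obtain ⟨f, hfA, hfC, hfB⟩ := exists_equiv_of_partition hA hC hB hAC hAB hCB huniv
  have hcl : ∀ x y, f x ∈ A ∪ C → f y ∈ A ∪ C → (G.Adj (f x) (f y) ↔ x ≠ y) := fun x y hx hy =>
    ⟨fun h => ne_of_apply_ne f h.ne, fun h => hclique _ hx _ hy (f.injective.ne h)⟩
  have hA' : ∀ i, f (.inl i) ∈ A ∪ C := fun i => mem_union_left _ (hfA i)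
  have hC' : ∀ i, f (.inr (.inl i)) ∈ A ∪ C := fun i => mem_union_right _ (hfC i)
  refine ⟨RelIso.symm ⟨f, ?_⟩⟩
  rintro (i | i | i) (j | j | j)
  · simp [hcl _ _ (hA' i) (hA' j), join, K]
  · simp [hcl _ _ (hA' i) (hC' j), join]
  · simp [hfull _ (hfA i) _ (hfB j), join]
  · simp [hcl _ _ (hC' i) (hA' j), join]
  · simp [hcl _ _ (hC' i) (hC' j), join, K]
  · simp [hnone _ (hfC i) _ (hfB j), join]
  · simp [(hfull _ (hfA j) _ (hfB i)).symm, join]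
  · simp only [join, SimpleGraph.sup_adj, SimpleGraph.sum_adj_inr, completeBipartiteGraph_adj]
    simpa using fun h => hnone _ (hfC j) _ (hfB i) (G.adj_symm h)
  · rcases hR with ⟨rfl, h⟩ | ⟨rfl, h⟩
    · have : G.Adj (f (.inr (.inr i))) (f (.inr (.inr j))) ↔ i ≠ j :=
        ⟨fun h => by rintro rfl; exact h.ne rfl,
          fun hne => h _ (hfB i) _ (hfB j) (f.injective.ne (by simpa using hne))⟩
      simp [this, join]
    · simp [h _ (hfB i) _ (hfB j), join]

theorem adj_iff_of_degIn_le {G H : SimpleGraph V} (h : G ≤ H) {U : Finset V} {v : V}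
    (hdeg : degIn H U v ≤ degIn G U v) {w : V} (hw : w ∈ U) : G.Adj v w ↔ H.Adj v w := by
  classical
  refine ⟨fun hvw => h hvw, fun hvw => ?_⟩
  have hsub : ({w ∈ U | G.Adj v w} : Finset V) ⊆ {w ∈ U | H.Adj v w} :=
    monotone_filter_right U fun _ _ hx => h hx
  rw [degIn_eq_card_filter, degIn_eq_card_filter] at hdeg
  have : w ∈ ({w ∈ U | G.Adj v w} : Finset V) := by
    rw [eq_of_subset_of_card_le hsub hdeg]
    exact mem_filter.2 ⟨hw, hvw⟩
  exact (mem_filter.1 this).2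

/-- A large graph of minimum degree at least `δ` and large spectral radius which stays
non-Hamiltonian on the complement of some set of at most `k` vertices is one of the two extremal
graphs. -/
theorem nonempty_iso_of_not_hamOn [Fintype V] [DecidableEq V] {G : SimpleGraph V}
    [DecidableRel G.Adj] {k δ : ℕ} (hδ : k + 2 ≤ δ)
    (hn : 6 * (δ - k) * k + 8 * (δ - k) + (δ - k + 1) * (12 * (δ - k) + 1) +
      (δ - k) * δ * (δ + 1) + δ + k + 3 ≤ Fintype.card V)
    (hdeg : ∀ v, δ ≤ degIn G univ v)
    (hspec : (Fintype.card V : ℝ) - (δ - k : ℕ) - 1 ≤ spectralRadius G)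
    {X : Finset V} (hX : #X ≤ k) (hnot : ¬ HamOn G (univ \ X)) :
    Nonempty (G ≃g graphH (Fintype.card V) k δ) ∨
      Nonempty (G ≃g graphL (Fintype.card V) k δ) := by
  obtain ⟨s, hs⟩ : ∃ s, s = δ - k := ⟨_, rfl⟩
  set n := Fintype.card V with hnV
  rw [← hs] at hn hspec
  have hpos₁ : 0 ≤ s * k := Nat.zero_le _
  have hpos₂ : 0 ≤ (s + 1) * (12 * s + 1) := Nat.zero_le _
  have hpos₃ : 0 ≤ s * δ * (δ + 1) := Nat.zero_le _
  have hk₁ : 6 * s * k = 6 * (s * k) := by ring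
  have hk₂ : 4 * s * k = 4 * (s * k) := by ring
  have hk₃ : 2 * s * k = 2 * (s * k) := by ring
  rw [hk₁] at hn
  obtain ⟨U, hU⟩ : ∃ U, U = univ \ X := ⟨_, rfl⟩
  have hXU : Disjoint U X := hU ▸ sdiff_disjoint
  have huniv : U ∪ X = univ := hU ▸ sdiff_union_of_subset (subset_univ X)
  have hcardU : #U + #X = n := by
    rw [← card_union_of_disjoint hXU, huniv, card_univ]
  have hdegU : ∀ v, degIn G univ v = degIn G U v + degIn G X v := fun v => by
    rw [← huniv, degIn_union G hXU]
  rw [← hU] at hnot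
  obtain ⟨H, hGH, hH, hcl⟩ := exists_closed_of_not_hamOn hnot
  have hsum : ∑ v ∈ U, degIn Hᶜ U v ≤ 2 * s * n := by
    calc _ ≤ ∑ v ∈ U, degIn Gᶜ univ v := sum_le_sum fun v _ =>
          degIn_mono (compl_le_compl hGH) (subset_univ U) v
      _ ≤ ∑ v, degIn Gᶜ univ v := sum_le_sum_of_subset (subset_univ U)
      _ ≤ _ := sum_degIn_compl_le (by omega)
          (fun v => le_trans (by omega) (hdeg v)) hspec
  have hlow : #(lowDeg H U) ≤ s :=
    card_lowDeg_le hcl (k := k) (n := n) (by omega) hsum (by omega) (by omega)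
  obtain ⟨B, T, hBU, hTU, hB, hBd, hBT, hcases⟩ := extremal_structure hcl (s := s) (by omega) hH
    (fun v _ => by
      have h1 := hdeg v
      have h2 := hdegU v
      have h3 := degIn_le_card G X v
      have h4 := degIn_mono hGH (le_refl U) v
      omega) hlow (by omega)
  -- Squeeze: δ ≤ deg b ≤ s + |X| ≤ s + k = δ, so equality holds throughout.
  have hb : ∀ b ∈ B, degIn G U b = s ∧ degIn G X b = k ∧ #X = k := fun b hb => by
    have h1 := hdeg b
    have h2 := hdegU b
    have h3 := degIn_le_card G X b
    have h4 := degIn_mono hGH (le_refl U) b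
    have h5 := hBd b hb
    omega
  obtain ⟨b₀, hb₀⟩ : B.Nonempty := card_pos.1 (by omega)
  have hXk : #X = k := (hb b₀ hb₀).2.2
  have hadj : ∀ b ∈ B, ∀ w ∈ U, G.Adj b w ↔ H.Adj b w := fun b hbB w hw =>
    adj_iff_of_degIn_le hGH (by rw [hBd b hbB, (hb b hbB).1]) hw
  have hadjX : ∀ b ∈ B, ∀ w ∈ X, G.Adj b w := fun b hbB =>
    degIn_eq_card_iff.1 (by rw [(hb b hbB).2.1, hXk])
  have hclique := isClique_compl_of_le_spectralRadius (d := δ) hB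
    (fun b hbB => by
      have h1 := hb b hbB
      have h2 := hdegU b
      omega) (by omega) hspec
  have hXT : Disjoint X T := (hXU.mono_left (hTU.trans sdiff_subset)).symm
  have hXB : Disjoint X B := (hXU.mono_left hBU).symm
  have hTB : Disjoint T B := sdiff_disjoint.mono_left hTU
  have hC : Disjoint (X ∪ T) ((U \ B) \ T) := by
    rw [disjoint_union_left]
    exact ⟨(hXU.mono_left (sdiff_subset.trans sdiff_subset)).symm, disjoint_sdiff⟩
  have hCB : Disjoint ((U \ B) \ T) B := sdiff_disjoint.mono_left sdiff_subset
  have hcardA : #(X ∪ T) = k + #T := by rw [card_union_of_disjoint hXT, hXk]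
  have hcardC : #((U \ B) \ T) + #T + s + k = n := by
    have h1 := card_sdiff_add_card_eq_card hTU
    have h2 := card_sdiff_add_card_eq_card hBU
    omega
  have hall : ∀ v, v ∈ X ∪ T ∨ v ∈ (U \ B) \ T ∨ v ∈ B := fun v => by
    have : v ∈ U ∪ X := huniv ▸ mem_univ v
    simp only [mem_union, mem_sdiff] at this ⊢
    tauto
  have hAB : Disjoint (X ∪ T) B := disjoint_union_left.2 ⟨hXB, hTB⟩
  have hcl' : ∀ u ∈ (X ∪ T) ∪ ((U \ B) \ T), ∀ v ∈ (X ∪ T) ∪ ((U \ B) \ T), u ≠ v → G.Adj u v := by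
    have h : ∀ u ∈ (X ∪ T) ∪ ((U \ B) \ T), u ∈ univ \ B := fun u hu =>
      mem_sdiff.2 ⟨mem_univ _, disjoint_left.1 (disjoint_union_left.2 ⟨hAB, hCB⟩) hu⟩
    exact fun u hu v hv => hclique u (h u hu) v (h v hv)
  have hfull : ∀ u ∈ X ∪ T, ∀ v ∈ B, G.Adj u v := fun u hu v hv => by
    rcases mem_union.1 hu with hu | hu
    · exact (hadjX v hv u hu).symm
    · exact ((hadj v hv u (mem_sdiff.1 (hTU hu)).1).2 ((hBT v hv u (hTU hu)).2 hu)).symm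
  have hnone : ∀ u ∈ (U \ B) \ T, ∀ v ∈ B, ¬ G.Adj u v := fun u hu v hv huv => by
    obtain ⟨hu', huT⟩ := mem_sdiff.1 hu
    exact huT ((hBT v hv u hu').1 (hGH huv.symm))
  rcases hcases with ⟨hT, hind⟩ | ⟨hT, hcomp⟩
  · exact .inl (nonempty_iso_join (by omega) (by omega) (by omega) hC hAB hCB hall hcl' hfull hnone
      (.inr ⟨rfl, fun u hu v hv huv => hind u hu v hv (hGH huv)⟩))
  · exact .inr (nonempty_iso_join (by omega) (by omega) (by omega) hC hAB hCB hall hcl' hfull hnone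
      (.inl ⟨rfl, fun u hu v hv huv => (hadj u hu v (hBU hv)).2 (hcomp u hu v hv huv)⟩))

end HamSpectral

theorem theorem2p5 (k δ : ℕ) (hδ : k + 2 ≤ δ) :
    ∃ N : ℕ, ∀ n : ℕ, N ≤ n →
      ∀ (V : Type*) [Fintype V] [DecidableEq V], Fintype.card V = n →
        ∀ (G : SimpleGraph V) [DecidableRel G.Adj],
          δ ≤ G.minDegree →
          (n : ℝ) - (δ : ℝ) + (k : ℝ) - 1 ≤ HamSpectral.spectralRadius G →
            HamSpectral.IsKHamiltonian k G ∨
              Nonempty (G ≃g HamSpectral.graphH n k δ) ∨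
              Nonempty (G ≃g HamSpectral.graphL n k δ) := by
  -- A sum dominating the size conditions of `card_lowDeg_le`, `extremal_structure` and
  -- `isClique_compl_of_le_spectralRadius` with d = δ, allowing for |U| ≥ n - k.
  refine ⟨6 * (δ - k) * k + 8 * (δ - k) + (δ - k + 1) * (12 * (δ - k) + 1) +
      (δ - k) * δ * (δ + 1) + δ + k + 3, ?_⟩
  rintro n hn V _ _ rfl G _ hdeg hspec
  rw [or_iff_not_imp_left]
  intro hnot
  unfold HamSpectral.IsKHamiltonian at hnot
  push Not at hnot
  obtain ⟨X, hX, hXnot⟩ := hnot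
  refine HamSpectral.nonempty_iso_of_not_hamOn hδ hn (fun v => ?_) ?_ hX fun hham => ?_
  · rw [HamSpectral.degIn_univ]
    exact hdeg.trans (G.minDegree_le_degree v)
  · rw [Nat.cast_sub (by omega)]
    linarith
  · obtain ⟨a, p, hp⟩ := hham.exists_isHamiltonianCycle (S := {v : V | v ∉ X}) (by simp)
    exact hXnot a p hp
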